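/- Let $A\in\mathbb{Z}^{r\times n}$ be an integer matrix. Call $A$ generic if any $r$ of its columns are linearly independent. If $A$ has full row rank $r$, let $\Delta(A)$ be the maximum of $|\det B|$ over all $r\times r$ submatrices $B$ of $A$; call $A$ $\Delta$-modular if $\Delta(A)=\Delta$, and $\Delta$-submodular if $\Delta(A)\le\Delta$. For a positive integer $m$ and $a,b\in\mathbb{Z}^m$, let $M(a,b)$ be the matrix with two rows (the matrix of type $m$ given by $a,b$) whose columns are $(0,1)^\intercal$ and, for each $k=1,\dots,m$, all $(k,j)^\intercal$ with $j\in\mathbb{Z}$, $a_k\le j\le b_k$ and $\gcd(j,k)=1$, each occurring exactly once (there is no column with first entry $k$ if $a_k>b_k$). Proposition. Let $\Delta\ge 2$ be an integer and let $A$ be a generic $\Delta$-modular matrix with two rows. Then there are a positive integer $m\le\sqrt{\pi/2}\,\sqrt{\Delta}$ and vectors $a,b\in\mathbb{Z}^m$ such that $M(a,b)$ is a generic $\Delta$-submodular matrix with at least as many columns as $A$. -/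

import Mathlib

/-- The integer matrix `A` with `r` rows is generic: any `r` (distinct) columns of `A` are
linearly independent. -/
def IsGenericMatrix {r : ℕ} {ι : Type*} (A : Matrix (Fin r) ι ℤ) : Prop :=
  ∀ f : Fin r ↪ ι, LinearIndependent ℝ fun i => (A.map (Int.cast : ℤ → ℝ)).col (f i)

/-- `Δ(A)`: the maximal absolute value of the determinant of an `r × r` submatrix of `A`. -/
noncomputable def maxAbsMinor {r : ℕ} {ι : Type*} [Fintype ι] (A : Matrix (Fin r) ι ℤ) : ℕ :=
  Finset.univ.sup fun f : Fin r ↪ ι => (A.submatrix id f).det.natAbs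

/-- `A` has full row rank and `Δ(A) = Δ`. -/
def IsDeltaModular {r : ℕ} {ι : Type*} [Fintype ι] (Δ : ℕ)
    (A : Matrix (Fin r) ι ℤ) : Prop :=
  (A.map (Int.cast : ℤ → ℝ)).rank = r ∧ maxAbsMinor A = Δ

/-- `A` has full row rank and `Δ(A) ≤ Δ`. -/
def IsDeltaSubmodular {r : ℕ} {ι : Type*} [Fintype ι] (Δ : ℕ)
    (A : Matrix (Fin r) ι ℤ) : Prop :=
  (A.map (Int.cast : ℤ → ℝ)).rank = r ∧ maxAbsMinor A ≤ Δ

/-- The second entries of the columns of `M(a,b)` with first entry `k`, where `lo = a_k` and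
`hi = b_k`: all integers `j` with `lo ≤ j ≤ hi` and `gcd(j,k) = 1`. -/
noncomputable def coprimeEntries (k : ℕ) (lo hi : ℤ) : Finset ℤ :=
  (Finset.Icc lo hi).filter fun j => Int.gcd j k = 1

/-- The columns of `M(a,b)`: the column `(0,1)` (index `none`), and one column `(k,j)` for every
`1 ≤ k ≤ m` and every `j` in `coprimeEntries k a_k b_k`. The entries `a_k`, `b_k` of the vectors
are `a i`, `b i` with `k = i + 1`. -/
abbrev TypeMColumn {m : ℕ} (a b : Fin m → ℤ) : Type :=
  Option (Σ i : Fin m, coprimeEntries (i.val + 1) (a i) (b i))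

/-- The matrix `M(a,b)` of type `m`. -/
def typeMMatrix {m : ℕ} (a b : Fin m → ℤ) : Matrix (Fin 2) (TypeMColumn a b) ℤ :=
  Matrix.of fun row c =>
    match c with
    | none => ![0, 1] row
    | some ⟨i, j⟩ => ![(i.val : ℤ) + 1, (j : ℤ)] row

/-!
Divide every column by the greatest common divisor of its entries: minors shrink but stay nonzero.
It remains to find a unimodular change of coordinates after which all first entries are at most
`m` in absolute value with `m` small. Then, up to sign, every column is `(0, 1)` or some `(k, j)`
with `1 ≤ k ≤ m`, and `a k`, `b k` are taken to be the least and the greatest second entry of the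
columns with first entry `k`. The columns of `M(a, b)` other than `(0, 1)` are convex combinations
of columns of the given matrix, so bilinearity of the determinant bounds their minors by `Δ`, and
the minors with `(0, 1)` are at most `m ≤ Δ`.

The bound on `m` (`exists_unimodular_abs_fst_le`) comes from choosing the coordinates such that `m`,
the maximum of the absolute values of the first entries, is minimal. After a shear, a column with
first entry `m` is `P = (m, p)` with `0 ≤ p < m`. By minimality the second coordinate and the
difference of the coordinates also take absolute values at least `m`, at columns `Q` and `R`.
The minors formed from `P`, `Q`, `R` cannot all be smaller than `3 m² / 4`
(`three_mul_sq_le_of_minors_le`), whence `m² ≤ 4 Δ / 3 ≤ π Δ / 2`.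
-/

/-! ### Matrices with two rows -/

theorem det_submatrix_fin_two {ι : Type*} (A : Matrix (Fin 2) ι ℤ) (f : Fin 2 → ι) :
    (A.submatrix id f).det = A 0 (f 0) * A 1 (f 1) - A 0 (f 1) * A 1 (f 0) := by
  simp [Matrix.det_fin_two]

theorem linearIndependent_cols_iff_det_ne_zero {r : ℕ} {ι : Type*} (A : Matrix (Fin r) ι ℤ)
    (f : Fin r → ι) :
    LinearIndependent ℝ (fun i => (A.map (Int.cast : ℤ → ℝ)).col (f i)) ↔
      (A.submatrix id f).det ≠ 0 := by
  have h := Matrix.linearIndependent_cols_iff_isUnit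
    (A := (A.submatrix id f).map (Int.cast : ℤ → ℝ))
  have h2 : ((A.submatrix id f).map (Int.cast : ℤ → ℝ)).det = ((A.submatrix id f).det : ℝ) :=
    (RingHom.map_det (Int.castRingHom ℝ) (A.submatrix id f)).symm
  rw [Matrix.isUnit_iff_isUnit_det, h2, isUnit_iff_ne_zero, Int.cast_ne_zero] at h
  exact h

theorem isGenericMatrix_fin_two_iff {ι : Type*} (A : Matrix (Fin 2) ι ℤ) :
    IsGenericMatrix A ↔ ∀ i j, i ≠ j → A 0 i * A 1 j - A 0 j * A 1 i ≠ 0 := by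
  constructor
  · intro h i j hij
    have hf : Function.Injective ![i, j] := by
      intro s t
      fin_cases s <;> fin_cases t <;> simp [hij, hij.symm]
    have := (linearIndependent_cols_iff_det_ne_zero A _).1 (h ⟨![i, j], hf⟩)
    simpa [det_submatrix_fin_two] using this
  · intro h f
    refine (linearIndependent_cols_iff_det_ne_zero A f).2 ?_
    rw [det_submatrix_fin_two]
    exact h _ _ (f.injective.ne (by decide))

theorem maxAbsMinor_fin_two_le_iff {ι : Type*} [Fintype ι] (A : Matrix (Fin 2) ι ℤ) (D : ℕ) :
    maxAbsMinor A ≤ D ↔ ∀ i j, |A 0 i * A 1 j - A 0 j * A 1 i| ≤ (D : ℤ) := by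
  unfold maxAbsMinor
  rw [Finset.sup_le_iff]
  constructor
  · intro h i j
    by_cases hij : i = j
    · subst hij
      simp
    have hf : Function.Injective ![i, j] := by
      intro s t
      fin_cases s <;> fin_cases t <;> simp [hij, Ne.symm hij]
    have := h ⟨![i, j], hf⟩ (Finset.mem_univ _)
    rw [det_submatrix_fin_two] at this
    simp only [Function.Embedding.coeFn_mk, Matrix.cons_val_zero, Matrix.cons_val_one] at this
    rw [Int.abs_eq_natAbs]
    exact_mod_cast this
  · intro h f _
    have := h (f 0) (f 1)
    rw [det_submatrix_fin_two]
    rw [Int.abs_eq_natAbs] at this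
    exact_mod_cast this

theorem rank_fin_two_eq_two_of_minor_ne_zero {ι : Type*} [Fintype ι] (A : Matrix (Fin 2) ι ℤ)
    {i j : ι} (h : A 0 i * A 1 j - A 0 j * A 1 i ≠ 0) :
    (A.map (Int.cast : ℤ → ℝ)).rank = 2 := by
  have hli := (linearIndependent_cols_iff_det_ne_zero A ![i, j]).2
    (by simpa [det_submatrix_fin_two] using h)
  have hspan : (A.map (Int.cast : ℤ → ℝ)).rank =
      Module.finrank ℝ (Submodule.span ℝ (Set.range (A.map (Int.cast : ℤ → ℝ)).col)) :=
    Matrix.rank_eq_finrank_span_cols _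
  have hcard := finrank_span_eq_card hli
  rw [Fintype.card_fin] at hcard
  refine le_antisymm ?_ ?_
  · exact (Matrix.rank_le_card_height _).trans_eq (Fintype.card_fin 2)
  · rw [hspan]
    refine hcard.symm.le.trans ?_
    refine Submodule.finrank_mono (Submodule.span_mono ?_)
    rintro _ ⟨t, rfl⟩
    exact Set.mem_range_self _

/-! ### Coordinates with small first entries -/

/-- Here `P = (m, p)`, `Q = (q, r)` and `R = (-a, b)`: at least one of the minors formed from them
is `3 * m ^ 2 / 4` or more. -/
theorem three_mul_sq_le_of_minors_le {m p q r a b D : ℤ} (hp0 : 0 ≤ p) (hpm : p < m)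
    (hqm : q ≤ m) (hr : m ≤ r) (ham : a ≤ m) (hb : m ≤ a + b)
    (hPQ : m * r - p * q ≤ D) (hPR : m * b + p * a ≤ D) (hQR : q * b + a * r ≤ D) :
    3 * m ^ 2 ≤ 4 * D := by
  by_contra! hcon
  have hm : 0 < m := by omega
  have hmm : 0 < m ^ 2 := by positivity
  -- `E > m² / 4` is the gap between the minors and `m²`; each minor bound gives a lower bound
  -- `E` for a product.
  obtain ⟨E, hE⟩ : ∃ E, E = m ^ 2 - D := ⟨_, rfl⟩
  have hE0 : 0 < E := by omega
  have h1 : E ≤ p * q := by nlinarith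
  have h2 : E ≤ (m - p) * a := by nlinarith
  have hp : 0 < p := by
    rcases hp0.eq_or_lt with h | h
    · rw [← h] at h1; omega
    · exact h
  have hq : 0 < q := by
    by_contra! h
    nlinarith
  have ha : 0 < a := by
    by_contra! h
    nlinarith
  have h3 : E ≤ (m - q) * (m - a) := by nlinarith
  have hD : 0 < D := by nlinarith
  have h4 : p * (m - q) ≤ m * p - E := by linarith
  have h5 : (m - p) * (m - a) ≤ m * (m - p) - E := by linarith
  have h6 : (p * (m - q)) * ((m - p) * (m - a)) ≤ (m * p - E) * (m * (m - p) - E) :=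
    mul_le_mul h4 h5 (mul_nonneg (by omega) (by omega))
      (le_trans (mul_nonneg hp0 (by omega)) h4)
  have h7 : (p * (m - p)) * E ≤ (p * (m - p)) * ((m - q) * (m - a)) :=
    mul_le_mul_of_nonneg_left h3 (mul_nonneg hp0 (by omega))
  have h8 : E * D ≤ (p * (m - p)) * D := by
    have : D = m ^ 2 - E := by omega
    rw [this]
    nlinarith
  have h9 : E ≤ p * (m - p) := le_of_mul_le_mul_right h8 hD
  nlinarith [sq_nonneg (2 * p - m)]

/-- If `m` is the maximum of `|x i|` and no coordinate `y + t * x` has a smaller maximum, then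
`m ^ 2 ≤ 4 * D / 3`. Replacing vectors by their negatives and shearing reduces this to
`three_mul_sq_le_of_minors_le`, with `Q` and `R` provided by two consecutive values of `t`. -/
theorem three_mul_sq_le_of_forall_shear {ι : Type*} (x y : ι → ℤ) {m D : ℤ} (hm : 0 < m)
    (hx : ∀ i, |x i| ≤ m) (hmax : ∃ i, |x i| = m)
    (hshear : ∀ t : ℤ, ∃ i, m ≤ |y i + t * x i|)
    (hdet : ∀ i j, |x i * y j - x j * y i| ≤ D) :
    3 * m ^ 2 ≤ 4 * D := by
  have sgn : ∀ z : ℤ, ∃ e : ℤ, (e = 1 ∨ e = -1) ∧ |z| = e * z := by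
    intro z
    rcases abs_choice z with h | h
    · exact ⟨1, Or.inl rfl, by rw [h]; ring⟩
    · exact ⟨-1, Or.inr rfl, by rw [h]; ring⟩
  have hdet' : ∀ i j, ∀ e f : ℤ, (e = 1 ∨ e = -1) → (f = 1 ∨ f = -1) →
      e * f * (x i * y j - x j * y i) ≤ D := by
    intro i j e f he hf
    have := abs_le.1 (hdet i j)
    rcases he with rfl | rfl <;> rcases hf with rfl | rfl <;> linarith
  have hx' : ∀ i, ∀ e : ℤ, (e = 1 ∨ e = -1) → e * x i ≤ m ∧ -m ≤ e * x i := by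
    intro i e he
    have := abs_le.1 (hx i)
    rcases he with rfl | rfl <;> constructor <;> linarith
  -- `t` is chosen such that the shear moves the second entry of `P` into `[0, m)`.
  obtain ⟨i, hi⟩ := hmax
  obtain ⟨e, he, hei⟩ := sgn (x i)
  obtain ⟨t, ht⟩ : ∃ t, t = -(e * y i / m) := ⟨_, rfl⟩
  obtain ⟨j, hj⟩ := hshear t
  obtain ⟨k, hk⟩ := hshear (t - 1)
  obtain ⟨f, hf, hfj⟩ := sgn (y j + t * x j)
  obtain ⟨g, hg, hgk⟩ := sgn (y k + (t - 1) * x k)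
  have hem : m = e * x i := by rw [← hei, hi]
  have hp : e * (y i + t * x i) = e * y i % m := by
    rw [Int.emod_def, ht]
    linear_combination (e * y i / m) * hem
  refine three_mul_sq_le_of_minors_le (m := m) (p := e * (y i + t * x i)) (q := f * x j)
    (r := f * (y j + t * x j)) (a := -(g * x k)) (b := g * (y k + t * x k)) ?_ ?_ ?_ ?_ ?_ ?_ ?_ ?_ ?_
  · rw [hp]; exact Int.emod_nonneg _ hm.ne'
  · rw [hp]; exact Int.emod_lt_of_pos _ hm
  · exact (hx' j f hf).1
  · rw [← hfj]; exact hj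
  · have := (hx' k g hg).2
    linarith
  · rw [hgk] at hk
    linarith
  · rw [hem]
    linarith [hdet' i j e f he hf]
  · rw [hem]
    linarith [hdet' i k e g he hg]
  · linarith [hdet' j k f g hf hg]

/-- Finitely many integer vectors, not all parallel and with all minors at most `D`, have
coordinates with respect to some basis of `ℤ ^ 2` whose first entries are at most `m` in absolute
value, where `m ^ 2 ≤ 4 * D / 3`. -/
theorem exists_unimodular_abs_fst_le {ι : Type*} [Finite ι] (x y : ι → ℤ) {D : ℤ}
    (hne : ∃ i j, x i * y j - x j * y i ≠ 0)
    (hdet : ∀ i j, |x i * y j - x j * y i| ≤ D) :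
    ∃ m : ℕ, 0 < m ∧ 3 * (m : ℤ) ^ 2 ≤ 4 * D ∧ ∃ a b c d : ℤ, a * d - b * c = 1 ∧
      ∀ i, |a * x i + b * y i| ≤ (m : ℤ) := by
  classical
  have hex : ∃ m : ℕ, ∃ a b c d : ℤ, a * d - b * c = 1 ∧
      ∀ i, |a * x i + b * y i| ≤ (m : ℤ) := by
    obtain ⟨M, hM⟩ := (Set.finite_range fun i => (x i).natAbs).bddAbove
    refine ⟨M, 1, 0, 0, 1, by ring, fun i => ?_⟩
    have : (x i).natAbs ≤ M := hM ⟨i, rfl⟩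
    simp only [one_mul, zero_mul, add_zero]
    rw [Int.abs_eq_natAbs]
    exact_mod_cast this
  obtain ⟨a, b, c, d, hu, hle⟩ := Nat.find_spec hex
  have hmin : ∀ k, k < Nat.find hex → _ := fun k => Nat.find_min hex (m := k)
  set m := Nat.find hex with hm_def
  have hfst : ∀ a b c d : ℤ, a * d - b * c = 1 → ∃ i, (m : ℤ) ≤ |a * x i + b * y i| := by
    intro a' b' c' d' hu'
    by_contra! hlt
    obtain ⟨i₀, -⟩ := hne
    have hm0 : 0 < m := by
      have := hlt i₀
      have := abs_nonneg (a' * x i₀ + b' * y i₀)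
      omega
    refine hmin (m - 1) (by omega) ⟨a', b', c', d', hu', fun i => ?_⟩
    have := hlt i
    omega
  have htr : ∀ i j, (a * x i + b * y i) * (c * x j + d * y j) -
      (a * x j + b * y j) * (c * x i + d * y i) = x i * y j - x j * y i := by
    intro i j
    linear_combination (x i * y j - x j * y i) * hu
  have hm0 : 0 < m := by
    by_contra! h0
    obtain ⟨i, j, hij⟩ := hne
    have h : ∀ i, a * x i + b * y i = 0 := by
      intro i
      have := hle i
      rw [← abs_nonpos_iff]
      omega
    apply hij
    rw [← htr i j, h i, h j]
    ring
  refine ⟨m, hm0, ?_, a, b, c, d, hu, hle⟩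
  refine three_mul_sq_le_of_forall_shear (fun i => a * x i + b * y i)
    (fun i => c * x i + d * y i) (by exact_mod_cast hm0) hle ?_ ?_ ?_
  · obtain ⟨i, hi⟩ := hfst a b c d hu
    exact ⟨i, le_antisymm (hle i) hi⟩
  · intro t
    obtain ⟨i, hi⟩ := hfst (c + t * a) (d + t * b) (-a) (-b) (by linear_combination hu)
    refine ⟨i, hi.trans_eq (congrArg abs ?_)⟩
    ring
  · intro i j
    simpa only [htr] using hdet i j

/-! ### Normalised columns -/

/-- Every nonzero integer vector is a multiple of a primitive vector which has positive first entry
or is `(0, 1)`. -/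
theorem exists_primitive_normalised {x y : ℤ} (h : x ≠ 0 ∨ y ≠ 0) :
    ∃ g x' y' : ℤ, g ≠ 0 ∧ x = g * x' ∧ y = g * y' ∧ Int.gcd y' x' = 1 ∧
      (0 < x' ∨ x' = 0 ∧ y' = 1) := by
  have hpos : 0 < Int.gcd x y := Int.gcd_pos_iff.2 h
  obtain ⟨x', y', hc, hx, hy⟩ := Int.exists_gcd_one hpos
  rw [Int.gcd_comm] at hc
  have hg : (Int.gcd x y : ℤ) ≠ 0 := by exact_mod_cast hpos.ne'
  obtain ⟨g, hgdef⟩ : ∃ g : ℤ, g = Int.gcd x y := ⟨_, rfl⟩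
  rw [← hgdef] at hx hy hg
  rcases lt_trichotomy x' 0 with hneg | hzero | hpos'
  · exact ⟨-g, -x', -y', neg_ne_zero.2 hg, by rw [hx]; ring, by rw [hy]; ring,
      by rwa [Int.gcd_neg, Int.neg_gcd], Or.inl (by omega)⟩
  · subst hzero
    rw [Int.gcd_zero_right] at hc
    rcases Int.natAbs_eq_iff.1 hc with h1 | h1
    · exact ⟨g, 0, 1, hg, by rw [hx]; ring, by rw [hy, h1]; push_cast; ring, by simp,
        Or.inr ⟨rfl, rfl⟩⟩
    · exact ⟨-g, 0, 1, neg_ne_zero.2 hg, by rw [hx]; ring, by rw [hy, h1]; push_cast; ring,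
        by simp, Or.inr ⟨rfl, rfl⟩⟩
  · exact ⟨g, x', y', hg, by rw [hx]; ring, by rw [hy]; ring, hc, Or.inl hpos'⟩

theorem eq_of_det_eq_zero_of_normalised {x y x' y' : ℤ} (hx : 0 < x) (hx' : 0 < x')
    (h : Int.gcd y x = 1) (h' : Int.gcd y' x' = 1) (hdet : x * y' - x' * y = 0) :
    x = x' ∧ y = y' := by
  have hxx : x = x' := by
    refine Int.dvd_antisymm hx.le hx'.le ?_ ?_
    · refine (Int.isCoprime_iff_gcd_eq_one.2 h).symm.dvd_of_dvd_mul_right (z := y) ⟨y', ?_⟩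
      linarith
    · refine (Int.isCoprime_iff_gcd_eq_one.2 h').symm.dvd_of_dvd_mul_right (z := y') ⟨y, ?_⟩
      linarith
  subst hxx
  refine ⟨rfl, ?_⟩
  have : x * y' = x * y := by linarith
  exact (mul_left_cancel₀ hx.ne' this).symm

/-- The least interval containing the second entries of the vectors with first entry `k`, as a
pair of bounds; if there are no such vectors, the interval is empty. -/
theorem exists_bounds_of_fst_eq {ι : Type*} [Finite ι] (x y : ι → ℤ) (k : ℤ) :
    ∃ lo hi : ℤ, (∀ i, x i = k → lo ≤ y i ∧ y i ≤ hi) ∧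
      (lo ≤ hi → (∃ i, x i = k ∧ y i = lo) ∧ ∃ i, x i = k ∧ y i = hi) := by
  by_cases hne : ∃ i, x i = k
  · have hfin : {i | x i = k}.Finite := Set.toFinite _
    obtain ⟨i, hi, hmin⟩ := hfin.exists_minimalFor y _ hne
    obtain ⟨j, hj, hmax⟩ := hfin.exists_maximalFor y _ hne
    refine ⟨y i, y j, fun l hl => ⟨?_, ?_⟩, fun _ => ⟨⟨i, hi, rfl⟩, ⟨j, hj, rfl⟩⟩⟩
    · exact (le_total (y i) (y l)).elim id (hmin hl)
    · exact (le_total (y l) (y j)).elim id (hmax hl)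
  · exact ⟨1, 0, fun i hi => (hne ⟨i, hi⟩).elim, fun h => by omega⟩

theorem abs_affine_le_of_endpoints {u v lo hi j D : ℤ} (h1 : lo ≤ j) (h2 : j ≤ hi)
    (hlo : |u - v * lo| ≤ D) (hhi : |u - v * hi| ≤ D) : |u - v * j| ≤ D := by
  rw [abs_le] at *
  rcases le_total 0 v with hv | hv
  · have := mul_le_mul_of_nonneg_left h1 hv
    have := mul_le_mul_of_nonneg_left h2 hv
    constructor <;> linarith
  · have := mul_le_mul_of_nonpos_left h1 hv
    have := mul_le_mul_of_nonpos_left h2 hv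
    constructor <;> linarith

/-! ### Matrices of type `m` -/

theorem isGenericMatrix_typeMMatrix {m : ℕ} (a b : Fin m → ℤ) :
    IsGenericMatrix (typeMMatrix a b) := by
  rw [isGenericMatrix_fin_two_iff]
  rintro (_ | ⟨i, j, hj⟩) (_ | ⟨i', j', hj'⟩) hne hdet
  · exact hne rfl
  · simp [typeMMatrix] at hdet
    omega
  · simp [typeMMatrix] at hdet
    omega
  · simp only [typeMMatrix, Matrix.of_apply, Matrix.cons_val_zero, Matrix.cons_val_one] at hdet
    simp only [coprimeEntries, Finset.mem_filter] at hj hj'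
    have h := eq_of_det_eq_zero_of_normalised (by omega) (by omega)
      (by exact_mod_cast hj.2) (by exact_mod_cast hj'.2) hdet
    have hii : i = i' := Fin.ext (by omega)
    subst hii
    have hjj := h.2
    subst hjj
    exact hne rfl

/-- If the endpoints of every nonempty interval `[a k, b k]` come from a family of vectors with
minors at most `D`, then the minors of `M(a, b)` are at most `D`. -/
theorem maxAbsMinor_typeMMatrix_le {ι : Type*} {m D : ℕ} (hmD : m ≤ D) (x y : ι → ℤ)
    (hdet : ∀ i j, |x i * y j - x j * y i| ≤ (D : ℤ)) (a b : Fin m → ℤ)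
    (hab : ∀ k : Fin m, a k ≤ b k →
      (∃ i, x i = (k : ℤ) + 1 ∧ y i = a k) ∧ ∃ i, x i = (k : ℤ) + 1 ∧ y i = b k) :
    maxAbsMinor (typeMMatrix a b) ≤ D := by
  have key : ∀ u v : ℤ, (∀ i, |u * y i - x i * v| ≤ (D : ℤ)) →
      ∀ (k : Fin m) (j : ℤ), a k ≤ j → j ≤ b k → |u * j - ((k : ℤ) + 1) * v| ≤ (D : ℤ) := by
    intro u v h k j h1 h2
    obtain ⟨⟨i, hi1, hi2⟩, ⟨i', hi1', hi2'⟩⟩ := hab k (h1.trans h2)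
    have hlo := h i
    have hhi := h i'
    rw [hi1, hi2, abs_sub_comm] at hlo
    rw [hi1', hi2', abs_sub_comm] at hhi
    rw [abs_sub_comm]
    exact abs_affine_le_of_endpoints h1 h2 hlo hhi
  rw [maxAbsMinor_fin_two_le_iff]
  rintro (_ | ⟨k, j, hj⟩) (_ | ⟨k', j', hj'⟩)
  · simp [typeMMatrix]
  · simp only [typeMMatrix, Matrix.of_apply, Matrix.cons_val_zero, Matrix.cons_val_one]
    rw [abs_le]
    constructor <;> omega
  · simp only [typeMMatrix, Matrix.of_apply, Matrix.cons_val_zero, Matrix.cons_val_one]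
    rw [abs_le]
    constructor <;> omega
  · simp only [typeMMatrix, Matrix.of_apply, Matrix.cons_val_zero, Matrix.cons_val_one]
    simp only [coprimeEntries, Finset.mem_filter, Finset.mem_Icc] at hj hj'
    refine key _ _ (fun i => ?_) k' j' hj'.1.1 hj'.1.2
    have := key (x i) (y i) (fun i' => hdet i i') k j hj.1.1 hj.1.2
    rwa [abs_sub_comm] at this

theorem mainTheorem3 (Δ : ℕ) (hΔ : 2 ≤ Δ) (n : ℕ) (A : Matrix (Fin 2) (Fin n) ℤ)
    (hgen : IsGenericMatrix A) (hmod : IsDeltaModular Δ A) :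
    ∃ m : ℕ, 0 < m ∧ (m : ℝ) ≤ Real.sqrt (Real.pi / 2) * Real.sqrt (Δ : ℝ) ∧
      ∃ a b : Fin m → ℤ,
        IsGenericMatrix (typeMMatrix a b) ∧
        IsDeltaSubmodular Δ (typeMMatrix a b) ∧
        n ≤ Fintype.card (TypeMColumn a b) := by
  obtain ⟨hrank, hminor⟩ := hmod
  rw [isGenericMatrix_fin_two_iff] at hgen
  have hn : 2 ≤ n := by
    have := (A.map (Int.cast : ℤ → ℝ)).rank_le_width
    omega
  have hdet := (maxAbsMinor_fin_two_le_iff A Δ).1 hminor.le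
  have hother : ∀ i : Fin n, ∃ j, i ≠ j := by
    intro i
    have : Nontrivial (Fin n) := Fin.nontrivial_iff_two_le.2 hn
    obtain ⟨j, hj⟩ := exists_ne i
    exact ⟨j, hj.symm⟩
  let i₀ : Fin n := ⟨0, by omega⟩
  obtain ⟨j₀, hij₀⟩ := hother i₀
  obtain ⟨m, hm0, hmΔ, α, β, γ, δ, hu, hle⟩ := exists_unimodular_abs_fst_le (A 0) (A 1)
    ⟨i₀, j₀, hgen _ _ hij₀⟩ hdet
  have htr : ∀ i j, (α * A 0 i + β * A 1 i) * (γ * A 0 j + δ * A 1 j) -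
      (α * A 0 j + β * A 1 j) * (γ * A 0 i + δ * A 1 i) = A 0 i * A 1 j - A 0 j * A 1 i := by
    intro i j
    linear_combination (A 0 i * A 1 j - A 0 j * A 1 i) * hu
  have hnorm := fun i => exists_primitive_normalised
    (x := α * A 0 i + β * A 1 i) (y := γ * A 0 i + δ * A 1 i) (by
      by_contra! h
      obtain ⟨j, hij⟩ := hother i
      apply hgen i j hij
      rw [← htr i j, h.1, h.2]
      ring)
  choose g x y hg hx hy hcop hsign using hnorm
  have hminors : ∀ i j, A 0 i * A 1 j - A 0 j * A 1 i =
      (g i * g j) * (x i * y j - x j * y i) := by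
    intro i j
    rw [← htr i j, hx, hx, hy, hy]
    ring
  have hne : ∀ i j, i ≠ j → x i * y j - x j * y i ≠ 0 := by
    intro i j hij h0
    apply hgen i j hij
    rw [hminors, h0, mul_zero]
  have hdet' : ∀ i j, |x i * y j - x j * y i| ≤ (Δ : ℤ) := by
    intro i j
    refine le_trans ?_ (hdet i j)
    rw [hminors, abs_mul]
    exact le_mul_of_one_le_left (abs_nonneg _) (Int.one_le_abs (mul_ne_zero (hg i) (hg j)))
  have hx0 : ∀ i, 0 ≤ x i := fun i => by rcases hsign i with h | h <;> omega
  have hxm : ∀ i, x i ≤ m := by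
    intro i
    have h := hle i
    rw [hx, abs_mul] at h
    exact (le_abs_self _).trans
      ((le_mul_of_one_le_left (abs_nonneg _) (Int.one_le_abs (hg i))).trans h)
  choose a b hab hends using fun k : Fin m => exists_bounds_of_fst_eq x y ((k : ℤ) + 1)
  -- Each normalised column is a column of `M(a, b)`.
  have hcol : ∀ i, ∃ c : TypeMColumn a b,
      typeMMatrix a b 0 c = x i ∧ typeMMatrix a b 1 c = y i := by
    intro i
    rcases hsign i with hpos | ⟨h0, h1⟩
    · have hk : (x i - 1).toNat < m := by have := hxm i; omega
      have hk1 : (((x i - 1).toNat : ℕ) : ℤ) + 1 = x i := by omega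
      have hb := hab ⟨(x i - 1).toNat, hk⟩ i hk1.symm
      refine ⟨some ⟨⟨(x i - 1).toNat, hk⟩, ⟨y i, ?_⟩⟩, hk1, rfl⟩
      simp only [coprimeEntries, Finset.mem_filter, Finset.mem_Icc]
      refine ⟨hb, ?_⟩
      push_cast
      rw [hk1]
      exact hcop i
    · exact ⟨none, h0.symm, h1.symm⟩
  choose c hc0 hc1 using hcol
  have hmΔ' : m ≤ Δ := by
    zify
    by_contra! hlt
    nlinarith
  refine ⟨m, hm0, ?_, a, b, isGenericMatrix_typeMMatrix a b, ⟨?_, ?_⟩, ?_⟩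
  · rw [← Real.sqrt_mul (by positivity)]
    apply Real.le_sqrt_of_sq_le
    have h : 3 * (m : ℝ) ^ 2 ≤ 4 * (Δ : ℝ) := by exact_mod_cast hmΔ
    have hΔ0 : (0 : ℝ) ≤ Δ := Nat.cast_nonneg _
    nlinarith [Real.pi_gt_three]
  · refine rank_fin_two_eq_two_of_minor_ne_zero _ (i := c i₀) (j := c j₀) ?_
    rw [hc0, hc0, hc1, hc1]
    exact hne _ _ hij₀
  · exact maxAbsMinor_typeMMatrix_le hmΔ' x y hdet' a b hends
  · have hinj : Function.Injective c := by
      intro i j hij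
      by_contra h
      apply hne i j h
      rw [← hc0 i, ← hc0 j, ← hc1 i, ← hc1 j, hij, sub_self]
    simpa using Fintype.card_le_of_injective c hinj
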